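/- **Model.** There are $N$ mobile stations (MS) $1,\dots,N$ and a base station $0$; write $[N]=\{1,\dots,N\}$. There are a finite set $\mathcal S$ of topologies with probabilities $(\pi_s)_{s\in\mathcal S}$, finitely many power vectors $\ell_1,\dots,\ell_M$ with entries $\ell_{ijk}\ge 0$ (the power used on the link $(i,j)$ by $\ell_k$), link rates $\mu_{ij}(s,\ell_k)\ge 0$, and average power budgets $\overline P_i\ge 0$. In each slot $n$ a topology $s(n)$ is drawn, i.i.d. with law $\pi$. Given everything that happened in earlier slots and the topology $s(n)$, a randomized policy $\Delta$ draws a power vector $\ell(n)\in\{\ell_1,\dots,\ell_M\}$ and, for each MS $i$, decides whether its own queue ($\mathbb I_i(n)=1$) or its relay queue ($\mathbb I_i(n)=0$) is served on the link $(i,0)$. Exogenous packets arrive at the mobile stations, i.i.d. over slots and independently of topologies and decisions, in bounded integer numbers with mean vector $\lambda\in\mathbb R_{\ge0}^N$; for each $\lambda$ such an arrival law is fixed, arbitrarily. **Stability region.** The vector $\lambda\in\mathbb R_{\ge 0}^N$ is rate stable under $\Delta$ if, almost surely, the time averages of $\mu_{ij}(s(n),\ell(n))$ ($j\in[N]$,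 $j\ne i$), $\mu_{i0}(s(n),\ell(n))\,\mathbb I_i(n)$, $\mu_{i0}(s(n),\ell(n))\,(1-\mathbb I_i(n))$ and of the power $\sum_{j\in[N],j\ne i}\ell_{ij}(n)$ converge to constants $\overline\mu_{ij},\overline\mu_{i0},\overline\mu_{iR},\overline P_i^{\Delta}$, and for every $i$ $$\lambda_i\le\overline\mu_{i0}+\sum_{j\in[N],j\ne i}\overline\mu_{ij},\qquad \sum_{j\in[N],j\ne i}\overline\mu_{ji}\le\overline\mu_{iR},\qquad \overline P_i^{\Delta}\le\overline P_i .$$ Let $\mathcal C_{IID}$ be the set of all $\lambda\in\mathbb R_{\ge 0}^N$ that are rate stable under some randomized policy, and $\overline{\mathcal C}_{IID}$ its closure. **The set $\Lambda_{IID}$** consists of all $\lambda\in\mathbb R_{\ge0}^N$ for which there are $w_{sk}\ge0$ with $\sum_k w_{sk}=1$ for every $s$, and $q_{isk}\in[0,1]$, such that for every $i\in[N]$ $$\lambda_i\le\sum_{s,k}\pi_s w_{sk}\Big[\mu_{i0}(s,\ell_k)q_{isk}+\sum_{j\in[N],j\neq i}\mu_{ij}(s,\ell_k)\Big],$$ $$\sum_{s,k}\sum_{j\in[N],j\ne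 i}\pi_s w_{sk}\,\mu_{ji}(s,\ell_k)\le\sum_{s,k}\pi_s(1-q_{isk})w_{sk}\,\mu_{i0}(s,\ell_k),$$ $$\sum_{s,k}\pi_s w_{sk}\sum_{j\in[N],j\neq i}\ell_{ijk}\le\overline P_i .$$ **Theorem.** $\overline{\mathcal C}_{IID}=\Lambda_{IID}$, and in fact $\mathcal C_{IID}=\Lambda_{IID}$. More precisely, if $\lambda\in\mathbb R_{\ge0}^N$ and $(w,q)$ satisfy the three constraints, then $\lambda$ is rate stable under the stationary randomized policy that in topology $s$ chooses $\ell_k$ with probability $w_{sk}$ and then, independently for each MS $i$, serves its own queue with probability $q_{isk}$. If moreover in every slot each MS has a link of positive rate to at most one receiver, then, from every non-negative initial state, under this policy the own queues $X_i$, the relay queues $Y_i$ and the virtual power queues $U_i$ satisfy $X_i(n)/n\to0$, $Y_i(n)/n\to0$, $U_i(n)/n\to0$ almost surely. Here, with $\mu_{ij}=\mu_{ij}(s(n),\ell(n))$, all queues on the right taken at slot $n$, and $A_i(n)$ the number of exogenous arrivals at MS $i$ in slot $n$, $$X_i(n+1)=X_i-\sum_{j\in[N],j\ne i}\min(X_i,\mu_{ij})-\min(X_i,\mu_{i0}\mathbb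 I_i(n))+A_i(n),$$ $$Y_i(n+1)=Y_i-\min(Y_i,\mu_{i0}(1-\mathbb I_i(n)))+\sum_{j\in[N],j\ne i}\min(X_j,\mu_{ji}),$$ $$U_i(n+1)=U_i-\min(U_i,\overline P_i)+\sum_{j\in[N],j\ne i}\ell_{ij}(n).$$ -/

import Mathlib

open Filter Topology MeasureTheory

noncomputable section

/-- A power vector assigns a transmit power to every link `(i, r)`. The transmitter `i` is one of
the `N` mobile stations (MS); the receiver `r` is `none` for the base station (the node called `0`)
and `some j` for MS `j`. -/
abbrev PowerVector (N : ℕ) : Type := Fin N → Option (Fin N) → ℝ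

/-- Data of the relay network: `N` mobile stations, finitely many topologies `S` with a probability
vector, a finite list of power vectors indexed by `K`, the number `rate s l i r` of packets that the
link `(i, r)` can carry in one slot when the topology is `s` and the power vector is `l`, and the
average power budgets of the mobile stations. -/
structure RelayNetwork (N : ℕ) (S K : Type) [Fintype S] [Fintype K] where
  topLaw : S → ℝ
  topLaw_nonneg : ∀ s, 0 ≤ topLaw s
  topLaw_sum : ∑ s, topLaw s = 1
  vec : K → PowerVector N
  vec_nonneg : ∀ k i r, 0 ≤ vec k i r
  rate : S → PowerVector N → Fin N → Option (Fin N) → ℝ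
  rate_nonneg : ∀ s k i r, 0 ≤ rate s (vec k) i r
  budget : Fin N → ℝ
  budget_nonneg : ∀ i, 0 ≤ budget i

/-- For each vector of arrival rates, a law of the numbers of packets that arrive at the `N` mobile
stations in one slot: integer valued, bounded, and with the prescribed means. -/
structure ArrivalFamily (N : ℕ) where
  law : (Fin N → ℝ) → PMF (Fin N → ℕ)
  bounded : ∀ lam : Fin N → ℝ, (∀ i, 0 ≤ lam i) →
    ∃ Amax : ℕ, ∀ a ∈ (law lam).support, ∀ i, a i ≤ Amax
  mean : ∀ lam : Fin N → ℝ, (∀ i, 0 ≤ lam i) →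
    ∀ i, HasSum (fun a : Fin N → ℕ => ((law lam) a).toReal * (a i : ℝ)) (lam i)

/-- Everything that happens in one slot: the topology, the index of the chosen power vector, for
each MS whether its own queue (`true`) or its relay queue (`false`) is served on the link to the
base station, and the numbers of exogenous arrivals. -/
@[ext]
structure Slot (N : ℕ) (S K : Type) where
  top : S
  pow : K
  own : Fin N → Bool
  arr : Fin N → ℕ

instance (N : ℕ) (S K : Type) : MeasurableSpace (Slot N S K) := ⊤

/-- A causal randomized policy: the conditional distribution of the decision (power vector and
queue selection) in slot `n`, given all that happened in the slots before `n` (hence also the queue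
lengths) and the present topology. -/
structure Policy (N : ℕ) (S K : Type) [Fintype S] [Fintype K] where
  prob : (n : ℕ) → (Fin n → Slot N S K) → S → K × (Fin N → Bool) → ℝ
  prob_nonneg : ∀ n h s a, 0 ≤ prob n h s a
  prob_sum : ∀ n h s, ∑ a, prob n h s a = 1

/-- The parameters of a stationary randomized policy: `w s k` is the probability of the power vector
`k` in topology `s`, and `q i s k` the probability that MS `i` then serves its own queue. -/
structure StationaryRule (N : ℕ) (S K : Type) [Fintype S] [Fintype K] where
  w : S → K → ℝ
  w_nonneg : ∀ s k, 0 ≤ w s k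
  w_sum : ∀ s, ∑ k, w s k = 1
  q : Fin N → S → K → ℝ
  q_nonneg : ∀ i s k, 0 ≤ q i s k
  q_le_one : ∀ i s k, q i s k ≤ 1

/-- The stationary randomized policy with the given parameters; the queue selections of the
different mobile stations are made independently. -/
def StationaryRule.toPolicy {N : ℕ} {S K : Type} [Fintype S] [Fintype K]
    (ρ : StationaryRule N S K) : Policy N S K where
  prob _ _ s a := ρ.w s a.1 * ∏ i, (if a.2 i then ρ.q i s a.1 else 1 - ρ.q i s a.1)
  prob_nonneg _ _ s a := by
    refine mul_nonneg (ρ.w_nonneg _ _) (Finset.prod_nonneg fun i _ => ?_)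
    split_ifs
    · exact ρ.q_nonneg _ _ _
    · exact sub_nonneg.2 (ρ.q_le_one _ _ _)
  prob_sum _ _ s := by
    rw [Fintype.sum_prod_type]
    have key : ∀ k : K, ∑ b : Fin N → Bool,
        ∏ i, (if b i then ρ.q i s k else 1 - ρ.q i s k) = 1 := by
      intro k
      have h := Finset.prod_univ_sum (fun _ : Fin N => (Finset.univ : Finset Bool))
        (fun i b => if b then ρ.q i s k else 1 - ρ.q i s k)
      rw [Fintype.piFinset_univ] at h
      rw [← h]
      simp
    calc ∑ k, ∑ b : Fin N → Bool,
          ρ.w s k * ∏ i, (if b i then ρ.q i s k else 1 - ρ.q i s k)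
        = ∑ k, ρ.w s k := by
          refine Finset.sum_congr rfl fun k _ => ?_
          rw [← Finset.mul_sum, key k, mul_one]
      _ = 1 := ρ.w_sum s

namespace RelayNetwork

variable {N : ℕ} {S K : Type} [Fintype S] [Fintype K] (net : RelayNetwork N S K)

/-- `P` is the law of the trajectory of the system with i.i.d. topologies, i.i.d. arrivals of law
`ν`, and decisions taken by the policy `Δ`. The formula determines the probabilities of all
cylinder sets recursively, so for given `ν` and `Δ` there is exactly one such law. In every slot
the topology is independent of the past, and the arrivals are independent of the past, of the
topology and of the decision. -/
structure IsLaw (ν : PMF (Fin N → ℕ)) (Δ : Policy N S K)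
    (P : Measure (ℕ → Slot N S K)) : Prop where
  prob : IsProbabilityMeasure P
  step : ∀ (n : ℕ) (h : Fin n → Slot N S K) (x : Slot N S K),
    P {ω | (∀ m : Fin n, ω m = h m) ∧ ω n = x} =
      P {ω | ∀ m : Fin n, ω m = h m} *
        (ENNReal.ofReal (net.topLaw x.top) *
          ENNReal.ofReal (Δ.prob n h x.top (x.pow, x.own)) * ν x.arr)

/-- Service rate offered by the link from MS `i` to MS `j` in a slot. -/
def linkService (i j : Fin N) (x : Slot N S K) : ℝ := net.rate x.top (net.vec x.pow) i (some j)

/-- Service rate offered to the own queue of MS `i` by the link to the base station. -/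
def ownService (i : Fin N) (x : Slot N S K) : ℝ :=
  if x.own i then net.rate x.top (net.vec x.pow) i none else 0

/-- Service rate offered to the relay queue of MS `i` by the link to the base station. -/
def relayService (i : Fin N) (x : Slot N S K) : ℝ :=
  if x.own i then 0 else net.rate x.top (net.vec x.pow) i none

/-- The power that is charged to MS `i` when power vector `k` is used. -/
def power (i : Fin N) (k : K) : ℝ := ∑ j ∈ Finset.univ.erase i, net.vec k i (some j)

/-- Almost surely the time averages of `f` over the slots converge to the constant `a`. -/
def HasTimeAverage (P : Measure (ℕ → Slot N S K)) (f : Slot N S K → ℝ) (a : ℝ) : Prop :=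
  ∀ᵐ ω ∂P, Tendsto (fun T : ℕ => (∑ n ∈ Finset.range T, f (ω n)) / (T : ℝ)) atTop (𝓝 a)

/-- The rate vector `lam` is rate stable under the policy that generates the law `P`: the long-run
average service rates and powers exist; every own queue is offered at least its arrival rate; every
relay queue is offered at least the service rate of the links that lead into it; and the policy is
feasible, that is, it respects the average power budgets. -/
def RateStable (P : Measure (ℕ → Slot N S K)) (lam : Fin N → ℝ) : Prop :=
  ∃ (link : Fin N → Fin N → ℝ) (own relay pw : Fin N → ℝ),
    (∀ i j, j ≠ i → HasTimeAverage P (net.linkService i j) (link i j)) ∧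
    (∀ i, HasTimeAverage P (net.ownService i) (own i)) ∧
    (∀ i, HasTimeAverage P (net.relayService i) (relay i)) ∧
    (∀ i, HasTimeAverage P (fun x => net.power i x.pow) (pw i)) ∧
    (∀ i, lam i ≤ own i + ∑ j ∈ Finset.univ.erase i, link i j) ∧
    (∀ i, ∑ j ∈ Finset.univ.erase i, link j i ≤ relay i) ∧
    (∀ i, pw i ≤ net.budget i)

/-- The stability region: all rate vectors that are rate stable under some causal randomized
policy. -/
def stabilityRegion (arr : ArrivalFamily N) : Set (Fin N → ℝ) :=
  {lam | (∀ i, 0 ≤ lam i) ∧ ∃ (Δ : Policy N S K) (P : Measure (ℕ → Slot N S K)),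
    net.IsLaw (arr.law lam) Δ P ∧ net.RateStable P lam}

/-- The throughput, relay flow conservation and average power constraints on the parameters of a
stationary randomized policy. -/
structure Supports (ρ : StationaryRule N S K) (lam : Fin N → ℝ) : Prop where
  throughput : ∀ i, lam i ≤ ∑ s, ∑ k, net.topLaw s * ρ.w s k *
    (net.rate s (net.vec k) i none * ρ.q i s k +
      ∑ j ∈ Finset.univ.erase i, net.rate s (net.vec k) i (some j))
  relay : ∀ i, ∑ s, ∑ k, ∑ j ∈ Finset.univ.erase i,
      net.topLaw s * ρ.w s k * net.rate s (net.vec k) j (some i) ≤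
    ∑ s, ∑ k, net.topLaw s * (1 - ρ.q i s k) * ρ.w s k * net.rate s (net.vec k) i none
  power : ∀ i, ∑ s, ∑ k, net.topLaw s * ρ.w s k * net.power i k ≤ net.budget i

/-- The set `Λ` of the rate vectors for which some parameters satisfy the constraints. -/
def rateSet : Set (Fin N → ℝ) :=
  {lam | (∀ i, 0 ≤ lam i) ∧ ∃ ρ : StationaryRule N S K, net.Supports ρ lam}

/-- In every slot each MS has a link of positive rate to at most one receiver. -/
def SingleReceiver : Prop :=
  ∀ s k i (r r' : Option (Fin N)), r ≠ some i → r' ≠ some i →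
    net.rate s (net.vec k) i r ≠ 0 → net.rate s (net.vec k) i r' ≠ 0 → r = r'

end RelayNetwork

/-- Contents of the own queues `X`, the relay queues `Y` and the virtual power queues `U`. -/
structure QueueState (N : ℕ) where
  X : Fin N → ℝ
  Y : Fin N → ℝ
  U : Fin N → ℝ

/-- The queues after one slot. Departures on a link are limited by the offered service and by the
content of the queue; packets sent from MS `j` to MS `i` leave the own queue of `j` and enter the
relay queue of `i`; the virtual queue receives the power used and is drained at the rate of the
budget. -/
def RelayNetwork.queueStep {N : ℕ} {S K : Type} [Fintype S] [Fintype K]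
    (net : RelayNetwork N S K) (Q : QueueState N) (x : Slot N S K) : QueueState N where
  X i := Q.X i - ∑ j ∈ Finset.univ.erase i, min (Q.X i) (net.linkService i j x)
    - min (Q.X i) (net.ownService i x) + (x.arr i : ℝ)
  Y i := Q.Y i - min (Q.Y i) (net.relayService i x)
    + ∑ j ∈ Finset.univ.erase i, min (Q.X j) (net.linkService j i x)
  U i := Q.U i - min (Q.U i) (net.budget i) + net.power i x.pow

/-- The queues at the beginning of slot `n` along the trajectory `ω`. -/
def RelayNetwork.queues {N : ℕ} {S K : Type} [Fintype S] [Fintype K]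
    (net : RelayNetwork N S K) (Q0 : QueueState N) (ω : ℕ → Slot N S K) : ℕ → QueueState N
  | 0 => Q0
  | n + 1 => net.queueStep (RelayNetwork.queues net Q0 ω n) (ω n)

end

/-! Everything is read off the joint frequencies of (topology, power vector) and of the same event
together with "MS `i` serves its own queue". In these variables, essentially `π w` and `π w q`, the
service rates and powers are linear functionals. The frequencies compatible with the topology law
form a compact set `freqSet`, and each of its points comes from a stationary rule
(`exists_ruleFreq_eq`). So `rateSet` is the set of non-negative rate vectors meeting non-strict
linear constraints with some point of a compact set, and it is closed (`isClosed_rateSet`).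

Necessity: for an arbitrary causal policy, take the expected frequencies over the first `T` slots.
The topology of a slot is independent of the past, so they lie in `freqSet` (`IsLaw.avgFreq_mem`).
They need not converge, but a subsequence does. By dominated convergence every linear functional
that has an almost sure time average takes that average as its value at the limit point, which
therefore witnesses the constraints (`IsLaw.mem_rateSet`).

Sufficiency: under a stationary rule the slots are i.i.d., and the strong law identifies the time
averages with the functionals at `ruleFreq`. Queue growth is then a pathwise statement: a
single-server queue with average input at most its average service, equality allowed, is `o(n)`
(`tendsto_queue_div_nat`). -/

noncomputable section

/-! ### Sublinear growth of queues -/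

/-- A sequence of sublinear growth is bounded by affine functions of arbitrarily small slope. -/
lemma exists_abs_le_mul_add {u : ℕ → ℝ} (hu : Tendsto (fun n : ℕ => u n / (n : ℝ)) atTop (𝓝 0))
    {ε : ℝ} (hε : 0 < ε) : ∃ C : ℝ, 0 ≤ C ∧ ∀ n : ℕ, |u n| ≤ ε * n + C := by
  obtain ⟨M, hM⟩ := (Metric.tendsto_atTop.1 hu) ε hε
  refine ⟨∑ n ∈ Finset.range (M + 1), |u n|, Finset.sum_nonneg fun _ _ => abs_nonneg _,
    fun n => ?_⟩
  rcases lt_or_ge n (M + 1) with hn | hn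
  · have h1 : |u n| ≤ ∑ n ∈ Finset.range (M + 1), |u n| :=
      Finset.single_le_sum (f := fun n => |u n|) (fun _ _ => abs_nonneg _) (Finset.mem_range.2 hn)
    have h2 : 0 ≤ ε * (n : ℝ) := by positivity
    linarith
  · have hn0 : (0 : ℝ) < n := by
      have : 0 < n := by omega
      exact_mod_cast this
    have h1 := hM n (by omega)
    rw [Real.dist_eq, sub_zero, abs_div, abs_of_pos hn0, div_lt_iff₀ hn0] at h1
    have h2 : 0 ≤ ∑ n ∈ Finset.range (M + 1), |u n| := Finset.sum_nonneg fun _ _ => abs_nonneg _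
    linarith

lemma tendsto_sub_mul_div_nat {u : ℕ → ℝ} {a : ℝ}
    (hu : Tendsto (fun n : ℕ => u n / (n : ℝ)) atTop (𝓝 a)) :
    Tendsto (fun n : ℕ => (u n - a * n) / (n : ℝ)) atTop (𝓝 0) := by
  have h := hu.sub_const a
  rw [sub_self] at h
  refine h.congr' ?_
  filter_upwards [eventually_gt_atTop 0] with n hn
  have : (n : ℝ) ≠ 0 := by exact_mod_cast hn.ne'
  field_simp

/-- A queue whose average arrival rate is at most its average service rate grows sublinearly. -/
lemma tendsto_queue_div_nat {Q a b : ℕ → ℝ} {α β : ℝ} (hαβ : α ≤ β) (hQ : ∀ n, 0 ≤ Q n)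
    (hstep : ∀ n, Q (n + 1) ≤ max (Q n - b n) 0 + a n)
    (ha : Tendsto (fun T : ℕ => (∑ n ∈ Finset.range T, a n) / (T : ℝ)) atTop (𝓝 α))
    (hb : Tendsto (fun T : ℕ => (∑ n ∈ Finset.range T, b n) / (T : ℝ)) atTop (𝓝 β)) :
    Tendsto (fun n : ℕ => Q n / (n : ℝ)) atTop (𝓝 0) := by
  have bound : ∀ ε : ℝ, 0 < ε → ∃ C : ℝ, ∀ n : ℕ, Q n ≤ ε * n + C := by
    intro ε hε
    -- Slope `ε / 6` for each centred partial sum gives slope `ε / 3` for their difference `D` and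
    -- for single arrivals. The final slope is `2ε/3 + ε/3 = ε`.
    obtain ⟨C, hC0, hC⟩ := exists_abs_le_mul_add (tendsto_sub_mul_div_nat ha)
      (by positivity : 0 < ε / 6)
    obtain ⟨B, hB0, hB⟩ := exists_abs_le_mul_add (tendsto_sub_mul_div_nat hb)
      (by positivity : 0 < ε / 6)
    set D : ℕ → ℝ := fun n => (∑ m ∈ Finset.range n, a m - α * n) -
      (∑ m ∈ Finset.range n, b m - β * n) with hD
    have hDs : ∀ n, D (n + 1) = D n + (a n - b n) + (β - α) := by
      intro n
      simp only [hD, Finset.sum_range_succ]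
      push_cast
      ring
    have hDb : ∀ n, |D n| ≤ ε / 3 * n + (C + B) := by
      intro n
      have h1 := abs_le.1 (hC n)
      have h2 := abs_le.1 (hB n)
      rw [abs_le]
      constructor <;> simp only [hD] <;> linarith [h1.1, h1.2, h2.1, h2.2]
    -- A single arrival is a difference of consecutive partial sums, hence also sublinear.
    have hab : ∀ n : ℕ, a n ≤ ε / 3 * (n + 1 : ℝ) + (|α| + 2 * C) := by
      intro n
      have h1 := (abs_le.1 (hC (n + 1))).2
      have h2 := (abs_le.1 (hC n)).1
      rw [Finset.sum_range_succ] at h1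
      push_cast at h1
      linarith [le_abs_self α]
    -- While the queue is not emptied its increment is at most `a n - b n`, which is at most that of
    -- `D` because `α ≤ β`. If it empties, only `a n` remains; since `D` is at least `-(ε/3)(n+1) -
    -- (C+B)`, the slope `2ε/3` and the constant are just enough to cover it.
    have key : ∀ n : ℕ, Q n ≤ D n + 2 * ε / 3 * n + (Q 0 + |α| + 3 * C + B) := by
      intro n
      induction n with
      | zero =>
        have : D 0 = 0 := by simp [hD]
        rw [this]
        push_cast
        linarith [abs_nonneg α]
      | succ n ih =>
        refine (hstep n).trans ?_
        rw [← le_sub_iff_add_le]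
        refine max_le ?_ ?_
        · have := hDs n
          push_cast
          linarith
        · have h1 := (abs_le.1 (hDb (n + 1))).1
          have h2 := hab n
          have h3 := hQ 0
          push_cast at h1 ⊢
          linarith
    refine ⟨Q 0 + |α| + 4 * C + 2 * B, fun n => ?_⟩
    have h1 := (abs_le.1 (hDb n)).2
    have h2 := key n
    linarith
  rw [Metric.tendsto_atTop]
  intro ε hε
  obtain ⟨C, hC⟩ := bound (ε / 2) (by positivity)
  obtain ⟨M, hM⟩ := exists_nat_gt (C / (ε / 2))
  refine ⟨M + 1, fun n hn => ?_⟩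
  have hn0 : (0 : ℝ) < n := by
    have : 0 < n := by omega
    exact_mod_cast this
  have hMn : (M : ℝ) < n := by exact_mod_cast (by omega : M < n)
  rw [Real.dist_eq, sub_zero, abs_of_nonneg (div_nonneg (hQ n) hn0.le), div_lt_iff₀ hn0]
  have h1 : C < ε / 2 * n := by
    rw [div_lt_iff₀ (by positivity)] at hM
    nlinarith
  linarith [hC n]

lemma sub_min_eq_max (x y : ℝ) : x - min x y = max (x - y) 0 := by
  rcases le_total x y with h | h
  · rw [min_eq_left h, max_eq_right (by linarith), sub_self]
  · rw [min_eq_right h, max_eq_left (by linarith)]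

namespace RelayNetwork

variable {N : ℕ} {S K : Type} [Fintype S] [Fintype K] (net : RelayNetwork N S K)

lemma linkService_nonneg (i j : Fin N) (x : Slot N S K) : 0 ≤ net.linkService i j x :=
  net.rate_nonneg _ _ _ _

lemma power_nonneg (i : Fin N) (k : K) : 0 ≤ net.power i k :=
  Finset.sum_nonneg fun _ _ => net.vec_nonneg _ _ _

/-- With at most one active link per mobile station, an own queue is a single-server queue. -/
lemma SingleReceiver.queueStep_X {net : RelayNetwork N S K} (h : net.SingleReceiver)
    {Q : QueueState N} {i : Fin N} (hQ : 0 ≤ Q.X i) (x : Slot N S K) :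
    (net.queueStep Q x).X i =
      max (Q.X i - (net.ownService i x + ∑ j ∈ Finset.univ.erase i, net.linkService i j x)) 0
        + x.arr i := by
  simp only [queueStep]
  rw [← sub_min_eq_max]
  -- An active link to another MS silences the base-station link and all other links of `i`;
  -- otherwise only the base-station link can carry anything. Either way at most one `min` is
  -- nonzero.
  by_cases h0 : ∃ j ∈ Finset.univ.erase i, net.linkService i j x ≠ 0
  · obtain ⟨j, hj, hjx⟩ := h0
    have hji : (some j : Option (Fin N)) ≠ some i := by
      simpa using Finset.ne_of_mem_erase hj
    have hown : net.ownService i x = 0 := by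
      unfold ownService
      split_ifs
      · by_contra hne
        simpa using h x.top x.pow i none (some j) (by simp) hji hne hjx
      · rfl
    have hother : ∀ j' ∈ Finset.univ.erase i, j' ≠ j → net.linkService i j' x = 0 := by
      intro j' hj' hne
      by_contra hne'
      exact hne (Option.some_injective _ (h x.top x.pow i (some j') (some j)
        (by simpa using Finset.ne_of_mem_erase hj') hji hne' hjx))
    rw [Finset.sum_eq_single_of_mem j hj fun j' hj' hne => by
        rw [hother j' hj' hne, min_eq_right hQ],
      Finset.sum_eq_single_of_mem j hj hother, hown, min_eq_right hQ, sub_zero, zero_add]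
  · push Not at h0
    rw [Finset.sum_eq_zero fun j hj => by rw [h0 j hj, min_eq_right hQ],
      Finset.sum_eq_zero h0, sub_zero, add_zero]

/-- With several active links the own queue could be debited more than its content, since each `min`
sees the full queue. The single-server form excludes this; non-negative own queues then make the
relay inputs non-negative. -/
lemma SingleReceiver.queues_nonneg {net : RelayNetwork N S K} (h : net.SingleReceiver)
    {Q0 : QueueState N} (hQ : ∀ i, 0 ≤ Q0.X i ∧ 0 ≤ Q0.Y i ∧ 0 ≤ Q0.U i)
    (ω : ℕ → Slot N S K) (n : ℕ) :
    ∀ i, 0 ≤ (net.queues Q0 ω n).X i ∧ 0 ≤ (net.queues Q0 ω n).Y i ∧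
      0 ≤ (net.queues Q0 ω n).U i := by
  induction n with
  | zero => exact hQ
  | succ n ih =>
    intro i
    refine ⟨?_, ?_, ?_⟩
    · rw [queues, h.queueStep_X (ih i).1]
      positivity
    · simp only [queues, queueStep, sub_min_eq_max]
      exact add_nonneg (le_max_right _ _) (Finset.sum_nonneg fun j _ =>
        le_min (ih j).1 (net.linkService_nonneg _ _ _))
    · simp only [queues, queueStep, sub_min_eq_max]
      exact add_nonneg (le_max_right _ _) (net.power_nonneg _ _)

/-- Along every trajectory on which the time averages exist and satisfy the constraints of rate
stability, all queues grow sublinearly. -/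
lemma SingleReceiver.tendsto_queues_div {net : RelayNetwork N S K} (h : net.SingleReceiver)
    {Q0 : QueueState N} (hQ : ∀ i, 0 ≤ Q0.X i ∧ 0 ≤ Q0.Y i ∧ 0 ≤ Q0.U i)
    {ω : ℕ → Slot N S K} {lam own relay pw : Fin N → ℝ} {link : Fin N → Fin N → ℝ}
    (harr : ∀ i, Tendsto (fun T : ℕ => (∑ n ∈ Finset.range T, ((ω n).arr i : ℝ)) / (T : ℝ))
      atTop (𝓝 (lam i)))
    (hlink : ∀ i j, j ≠ i → Tendsto (fun T : ℕ =>
      (∑ n ∈ Finset.range T, net.linkService i j (ω n)) / (T : ℝ)) atTop (𝓝 (link i j)))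
    (hown : ∀ i, Tendsto (fun T : ℕ =>
      (∑ n ∈ Finset.range T, net.ownService i (ω n)) / (T : ℝ)) atTop (𝓝 (own i)))
    (hrelay : ∀ i, Tendsto (fun T : ℕ =>
      (∑ n ∈ Finset.range T, net.relayService i (ω n)) / (T : ℝ)) atTop (𝓝 (relay i)))
    (hpw : ∀ i, Tendsto (fun T : ℕ =>
      (∑ n ∈ Finset.range T, net.power i (ω n).pow) / (T : ℝ)) atTop (𝓝 (pw i)))
    (hX : ∀ i, lam i ≤ own i + ∑ j ∈ Finset.univ.erase i, link i j)
    (hY : ∀ i, ∑ j ∈ Finset.univ.erase i, link j i ≤ relay i)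
    (hU : ∀ i, pw i ≤ net.budget i) (i : Fin N) :
    Tendsto (fun n : ℕ => (net.queues Q0 ω n).X i / (n : ℝ)) atTop (𝓝 0) ∧
    Tendsto (fun n : ℕ => (net.queues Q0 ω n).Y i / (n : ℝ)) atTop (𝓝 0) ∧
    Tendsto (fun n : ℕ => (net.queues Q0 ω n).U i / (n : ℝ)) atTop (𝓝 0) := by
  have hpos := h.queues_nonneg hQ ω
  refine ⟨?_, ?_, ?_⟩
  · refine tendsto_queue_div_nat (hX i) (fun n => (hpos n i).1)
      (b := fun n => net.ownService i (ω n) + ∑ j ∈ Finset.univ.erase i, net.linkService i j (ω n))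
      (fun n => (h.queueStep_X (hpos n i).1 (ω n)).le) (harr i) ?_
    refine ((hown i).add (tendsto_finsetSum _ fun j hj =>
      hlink i j (Finset.ne_of_mem_erase hj))).congr fun T => ?_
    rw [Finset.sum_add_distrib, add_div, Finset.sum_comm, Finset.sum_div (Finset.univ.erase i)]
  · refine tendsto_queue_div_nat (hY i) (fun n => (hpos n i).2.1)
      (b := fun n => net.relayService i (ω n))
      (a := fun n => ∑ j ∈ Finset.univ.erase i, net.linkService j i (ω n)) (fun n => ?_) ?_
      (hrelay i)
    · simp only [queues, queueStep, sub_min_eq_max]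
      gcongr
      exact min_le_right _ _
    · refine (tendsto_finsetSum _ fun j hj =>
        hlink j i (Finset.ne_of_mem_erase hj).symm).congr fun T => ?_
      rw [Finset.sum_comm, Finset.sum_div]
  · refine tendsto_queue_div_nat (hU i) (fun n => (hpos n i).2.2)
      (b := fun _ => net.budget i)
      (a := fun n => net.power i (ω n).pow) (fun n => ?_) (hpw i) ?_
    · simp only [queues, queueStep, sub_min_eq_max]
      exact le_rfl
    · refine (tendsto_const_nhds (x := net.budget i)).congr' ?_
      filter_upwards [eventually_gt_atTop 0] with n hn
      have : (n : ℝ) ≠ 0 := by exact_mod_cast hn.ne'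
      simp
      field_simp

end RelayNetwork

/-! ### Frequencies of topologies, power vectors and queue selections -/

/-- Frequencies of the events that topology `s` occurs and power vector `k` is used (first
component), and that moreover MS `i` serves its own queue (second component). -/
abbrev Freq (N : ℕ) (S K : Type) : Type := (S → K → ℝ) × (Fin N → S → K → ℝ)

open Classical in
/-- The indicators of the events counted by `Freq`. -/
def Slot.freq {N : ℕ} {S K : Type} (x : Slot N S K) : Freq N S K :=
  (fun s k => if x.top = s ∧ x.pow = k then 1 else 0,
    fun i s k => if x.top = s ∧ x.pow = k ∧ x.own i then 1 else 0)

/-- The linear functional on frequencies with coefficients `c` and `d`, the latter applied to the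
queue selections of MS `i`. -/
def Freq.eval {N : ℕ} {S K : Type} [Fintype S] [Fintype K] (i : Fin N) (c d : S → K → ℝ)
    (z : Freq N S K) : ℝ :=
  ∑ s, ∑ k, (z.1 s k * c s k + z.2 i s k * d s k)

/-- Only the pair `(x.top, x.pow)` contributes. This is how per-slot services become linear
functionals of frequencies. -/
lemma Slot.eval_freq {N : ℕ} {S K : Type} [Fintype S] [Fintype K] (i : Fin N) (c d : S → K → ℝ)
    (x : Slot N S K) :
    Freq.eval i c d x.freq = c x.top x.pow + if x.own i then d x.top x.pow else 0 := by
  classical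
  unfold Freq.eval Slot.freq
  rw [Finset.sum_eq_single_of_mem x.top (Finset.mem_univ _),
    Finset.sum_eq_single_of_mem x.pow (Finset.mem_univ _)]
  · simp
  · intro k _ hk
    simp [hk.symm]
  · intro s _ hs
    simp [hs.symm]

lemma Freq.continuous_eval {N : ℕ} {S K : Type} [Fintype S] [Fintype K] (i : Fin N)
    (c d : S → K → ℝ) : Continuous (Freq.eval i c d) := by
  unfold Freq.eval
  fun_prop

namespace RelayNetwork

variable {N : ℕ} {S K : Type} [Fintype S] [Fintype K] (net : RelayNetwork N S K)

/-- The mean service rate of the link from MS `i` to MS `j`. -/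
def meanLink (i j : Fin N) : Freq N S K → ℝ :=
  Freq.eval i (fun s k => net.rate s (net.vec k) i (some j)) 0

/-- The mean service rate of the own queue of MS `i` on the link to the base station. -/
def meanOwn (i : Fin N) : Freq N S K → ℝ :=
  Freq.eval i 0 (fun s k => net.rate s (net.vec k) i none)

/-- The mean service rate of the relay queue of MS `i`. -/
def meanRelay (i : Fin N) : Freq N S K → ℝ :=
  Freq.eval i (fun s k => net.rate s (net.vec k) i none)
    (fun s k => -net.rate s (net.vec k) i none)

/-- The mean power of MS `i`. -/
def meanPower (i : Fin N) : Freq N S K → ℝ :=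
  Freq.eval i (fun _ k => net.power i k) 0

lemma meanLink_freq (i j : Fin N) (x : Slot N S K) :
    net.meanLink i j x.freq = net.linkService i j x := by
  simp [meanLink, Slot.eval_freq, linkService]

lemma meanOwn_freq (i : Fin N) (x : Slot N S K) :
    net.meanOwn i x.freq = net.ownService i x := by
  simp [meanOwn, Slot.eval_freq, ownService]

lemma meanRelay_freq (i : Fin N) (x : Slot N S K) :
    net.meanRelay i x.freq = net.relayService i x := by
  rw [meanRelay, Slot.eval_freq, relayService]
  split_ifs <;> simp

lemma meanPower_freq (i : Fin N) (x : Slot N S K) :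
    net.meanPower i x.freq = net.power i x.pow := by
  simp [meanPower, Slot.eval_freq]

/-- The frequencies `z` support the rate vector `lam`. -/
def Feasible (lam : Fin N → ℝ) (z : Freq N S K) : Prop :=
  (∀ i, lam i ≤ net.meanOwn i z + ∑ j ∈ Finset.univ.erase i, net.meanLink i j z) ∧
  (∀ i, ∑ j ∈ Finset.univ.erase i, net.meanLink j i z ≤ net.meanRelay i z) ∧
  (∀ i, net.meanPower i z ≤ net.budget i)

/-- The frequencies produced by a stationary randomized policy. -/
def ruleFreq (ρ : StationaryRule N S K) : Freq N S K :=
  (fun s k => net.topLaw s * ρ.w s k, fun i s k => net.topLaw s * ρ.w s k * ρ.q i s k)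

/-- The frequencies that are compatible with the law of the topologies. -/
def freqSet : Set (Freq N S K) :=
  {z | (∀ s k, 0 ≤ z.1 s k) ∧ (∀ s, ∑ k, z.1 s k = net.topLaw s) ∧
    (∀ i s k, 0 ≤ z.2 i s k) ∧ ∀ i s k, z.2 i s k ≤ z.1 s k}

/-- The parameters enter only through the products `π w` and `π w q`, in which the constraints are
linear. -/
lemma supports_iff (ρ : StationaryRule N S K) (lam : Fin N → ℝ) :
    net.Supports ρ lam ↔ net.Feasible lam (net.ruleFreq ρ) := by
  have h1 : ∀ i, net.meanOwn i (net.ruleFreq ρ) +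
      ∑ j ∈ Finset.univ.erase i, net.meanLink i j (net.ruleFreq ρ) =
      ∑ s, ∑ k, net.topLaw s * ρ.w s k * (net.rate s (net.vec k) i none * ρ.q i s k +
        ∑ j ∈ Finset.univ.erase i, net.rate s (net.vec k) i (some j)) := by
    intro i
    simp only [meanOwn, meanLink, Freq.eval, ruleFreq, Pi.zero_apply, mul_zero, zero_add, add_zero]
    rw [Finset.sum_comm (s := Finset.univ.erase i), ← Finset.sum_add_distrib]
    refine Finset.sum_congr rfl fun s _ => ?_
    rw [Finset.sum_comm (s := Finset.univ.erase i), ← Finset.sum_add_distrib]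
    refine Finset.sum_congr rfl fun k _ => ?_
    rw [← Finset.mul_sum]
    ring
  have h2 : ∀ i, ∑ j ∈ Finset.univ.erase i, net.meanLink j i (net.ruleFreq ρ) =
      ∑ s, ∑ k, ∑ j ∈ Finset.univ.erase i,
        net.topLaw s * ρ.w s k * net.rate s (net.vec k) j (some i) := by
    intro i
    simp only [meanLink, Freq.eval, ruleFreq, Pi.zero_apply, mul_zero, add_zero]
    rw [Finset.sum_comm]
    exact Finset.sum_congr rfl fun s _ => Finset.sum_comm
  have h3 : ∀ i, net.meanRelay i (net.ruleFreq ρ) =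
      ∑ s, ∑ k, net.topLaw s * (1 - ρ.q i s k) * ρ.w s k * net.rate s (net.vec k) i none := by
    intro i
    simp only [meanRelay, Freq.eval, ruleFreq]
    refine Finset.sum_congr rfl fun s _ => Finset.sum_congr rfl fun k _ => ?_
    ring
  have h4 : ∀ i, net.meanPower i (net.ruleFreq ρ) =
      ∑ s, ∑ k, net.topLaw s * ρ.w s k * net.power i k := by
    intro i
    simp [meanPower, Freq.eval, ruleFreq]
  simp only [Feasible, h1, h2, h3, h4]
  exact ⟨fun h => ⟨h.throughput, h.relay, h.power⟩, fun h => ⟨h.1, h.2.1, h.2.2⟩⟩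

lemma ruleFreq_mem_freqSet (ρ : StationaryRule N S K) : net.ruleFreq ρ ∈ net.freqSet := by
  refine ⟨fun s k => mul_nonneg (net.topLaw_nonneg s) (ρ.w_nonneg s k), fun s => ?_,
    fun i s k => mul_nonneg (mul_nonneg (net.topLaw_nonneg s) (ρ.w_nonneg s k)) (ρ.q_nonneg i s k),
    fun i s k => mul_le_of_le_one_right (mul_nonneg (net.topLaw_nonneg s) (ρ.w_nonneg s k))
      (ρ.q_le_one i s k)⟩
  simp only [ruleFreq]
  rw [← Finset.mul_sum, ρ.w_sum, mul_one]

/-- Without power vectors all sums over `K` vanish, while the topology masses add up to 1. -/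
lemma nonempty_of_mem_freqSet {z : Freq N S K} (hz : z ∈ net.freqSet) : Nonempty K := by
  by_contra hK
  rw [not_nonempty_iff] at hK
  have h := net.topLaw_sum
  rw [← Finset.sum_congr rfl fun s _ => hz.2.1 s] at h
  simp at h

/-- All frequencies compatible with the law of the topologies are produced by a stationary
randomized policy. -/
lemma exists_ruleFreq_eq {z : Freq N S K} (hz : z ∈ net.freqSet) :
    ∃ ρ : StationaryRule N S K, net.ruleFreq ρ = z := by
  classical
  obtain ⟨k0⟩ := net.nonempty_of_mem_freqSet hz
  obtain ⟨h0, hsum, hg0, hg⟩ := hz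
  have hv : ∀ s k, net.topLaw s = 0 → z.1 s k = 0 := by
    intro s k hs
    have h := hsum s
    rw [hs, Finset.sum_eq_zero_iff_of_nonneg fun k _ => h0 s k] at h
    exact h k (Finset.mem_univ _)
  -- Conditional probabilities. Topologies of mass zero get the arbitrary `k0`, so that `w s` is
  -- still a probability vector. In `q` the convention `0 / 0 = 0` is harmless: `z.2 ≤ z.1` forces
  -- `z.2 = 0` wherever `z.1 = 0`.
  refine ⟨{ w := fun s k => if net.topLaw s = 0 then (if k = k0 then 1 else 0)
              else z.1 s k / net.topLaw s
            w_nonneg := fun s k => ?_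
            w_sum := fun s => ?_
            q := fun i s k => z.2 i s k / z.1 s k
            q_nonneg := fun i s k => div_nonneg (hg0 i s k) (h0 s k)
            q_le_one := fun i s k => div_le_one_of_le₀ (hg i s k) (h0 s k) }, ?_⟩
  · split_ifs
    exacts [zero_le_one, le_rfl, div_nonneg (h0 s k) (net.topLaw_nonneg s)]
  · split_ifs with hs
    · simp
    · rw [← Finset.sum_div, hsum, div_self hs]
  · have hw : ∀ s k, net.topLaw s * (if net.topLaw s = 0 then (if k = k0 then 1 else 0)
        else z.1 s k / net.topLaw s) = z.1 s k := by
      intro s k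
      by_cases hs : net.topLaw s = 0
      · rw [hs, zero_mul, hv s k hs]
      · rw [if_neg hs, mul_div_cancel₀ _ hs]
    refine Prod.ext (funext fun s => funext fun k => hw s k)
      (funext fun i => funext fun s => funext fun k => ?_)
    simp only [ruleFreq, hw]
    by_cases hz1 : z.1 s k = 0
    · have h1 := hg i s k
      have h2 := hg0 i s k
      rw [hz1, zero_mul]
      linarith
    · rw [mul_div_cancel₀ _ hz1]

/-- Finitely many coordinates, all between 0 and 1 because they are dominated by topology masses,
and closed defining conditions. -/
lemma isCompact_freqSet : IsCompact net.freqSet := by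
  have hb : net.freqSet ⊆ Set.Icc 0 (1, 1) := by
    rintro z ⟨h0, hsum, hg0, hg⟩
    have h1 : ∀ s k, z.1 s k ≤ 1 := by
      intro s k
      calc z.1 s k ≤ ∑ k, z.1 s k :=
            Finset.single_le_sum (f := fun k => z.1 s k) (fun k _ => h0 s k) (Finset.mem_univ k)
        _ = net.topLaw s := hsum s
        _ ≤ ∑ s, net.topLaw s :=
            Finset.single_le_sum (fun s _ => net.topLaw_nonneg s) (Finset.mem_univ s)
        _ = 1 := net.topLaw_sum
    exact ⟨⟨h0, hg0⟩, ⟨h1, fun i s k => (hg i s k).trans (h1 s k)⟩⟩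
  refine isCompact_Icc.of_isClosed_subset ?_ hb
  simp only [freqSet, Set.ofPred_and, Set.ofPred_forall]
  refine IsClosed.inter ?_ (IsClosed.inter ?_ (IsClosed.inter ?_ ?_)) <;>
    refine isClosed_iInter fun _ => ?_
  · exact isClosed_iInter fun _ => isClosed_le (by fun_prop) (by fun_prop)
  · exact isClosed_eq (by fun_prop) (by fun_prop)
  · exact isClosed_iInter fun _ => isClosed_iInter fun _ => isClosed_le (by fun_prop) (by fun_prop)
  · exact isClosed_iInter fun _ => isClosed_iInter fun _ => isClosed_le (by fun_prop) (by fun_prop)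

lemma mem_rateSet_iff (lam : Fin N → ℝ) :
    lam ∈ net.rateSet ↔ (∀ i, 0 ≤ lam i) ∧ ∃ z ∈ net.freqSet, net.Feasible lam z := by
  refine and_congr_right fun _ => ⟨fun ⟨ρ, hρ⟩ => ?_, fun ⟨z, hz, hf⟩ => ?_⟩
  · exact ⟨_, net.ruleFreq_mem_freqSet ρ, (net.supports_iff ρ lam).1 hρ⟩
  · obtain ⟨ρ, rfl⟩ := net.exists_ruleFreq_eq hz
    exact ⟨ρ, (net.supports_iff ρ lam).2 hf⟩

/-- Choose frequencies for each term of a convergent sequence of rate vectors and pass to a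
convergent subsequence; the non-strict inequalities survive in the limit. -/
lemma isClosed_rateSet : IsClosed net.rateSet := by
  rw [← isSeqClosed_iff_isClosed]
  intro u lam hu hlim
  simp only [mem_rateSet_iff] at hu ⊢
  choose hu0 z hz hf using hu
  have hlim' := tendsto_pi_nhds.1 hlim
  obtain ⟨z₀, hz₀, φ, hφ, hzlim⟩ := net.isCompact_freqSet.tendsto_subseq hz
  have ev : ∀ (i : Fin N) (c d : S → K → ℝ), Tendsto (fun n => Freq.eval i c d (z (φ n))) atTop
      (𝓝 (Freq.eval i c d z₀)) := fun i c d =>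
    ((Freq.continuous_eval i c d).tendsto z₀).comp hzlim
  refine ⟨fun i => ge_of_tendsto' (hlim' i) fun n => hu0 n i, z₀, hz₀, fun i => ?_, fun i => ?_,
    fun i => ?_⟩
  · exact le_of_tendsto_of_tendsto' ((hlim' i).comp hφ.tendsto_atTop)
      ((ev i _ _).add (tendsto_finsetSum _ fun j _ => ev i _ _)) fun n => (hf (φ n)).1 i
  · exact le_of_tendsto_of_tendsto' (tendsto_finsetSum _ fun j _ => ev j _ _) (ev i _ _)
      fun n => (hf (φ n)).2.1 i
  · exact le_of_tendsto' (ev i _ _) fun n => (hf (φ n)).2.2 i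

end RelayNetwork

/-! ### Stable rate vectors are supported by a stationary policy -/

instance (N : ℕ) (S K : Type) : DiscreteMeasurableSpace (Slot N S K) := ⟨fun _ => trivial⟩

instance (N : ℕ) (S K : Type) [Finite S] [Finite K] : Countable (Slot N S K) :=
  Function.Injective.countable (f := fun x : Slot N S K => (x.top, x.pow, x.own, x.arr))
    fun x y h => by
      simp only [Prod.mk.injEq] at h
      exact Slot.ext h.1 h.2.1 h.2.2.1 h.2.2.2

/-- `Freq.eval` as a continuous linear map. -/
def Freq.evalL {N : ℕ} {S K : Type} [Fintype S] [Fintype K] (i : Fin N) (c d : S → K → ℝ) :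
    Freq N S K →L[ℝ] ℝ where
  toFun := Freq.eval i c d
  map_add' z z' := by
    simp only [Freq.eval, ← Finset.sum_add_distrib]
    refine Finset.sum_congr rfl fun s _ => Finset.sum_congr rfl fun k _ => ?_
    simp only [Prod.fst_add, Prod.snd_add, Pi.add_apply]
    ring
  map_smul' r z := by
    simp only [Freq.eval, Finset.smul_sum, RingHom.id_apply]
    refine Finset.sum_congr rfl fun s _ => Finset.sum_congr rfl fun k _ => ?_
    simp only [Prod.smul_fst, Prod.smul_snd, Pi.smul_apply, smul_eq_mul]
    ring
  cont := Freq.continuous_eval i c d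

/-- The frequency of topology `s` and power vector `k` as a linear functional. -/
def Freq.powL {N : ℕ} {S K : Type} [Fintype S] [Fintype K] (s : S) (k : K) :
    Freq N S K →L[ℝ] ℝ :=
  (ContinuousLinearMap.proj k).comp ((ContinuousLinearMap.proj s).comp
    (ContinuousLinearMap.fst ℝ (S → K → ℝ) (Fin N → S → K → ℝ)))

/-- The frequency of topology `s`, power vector `k` and service of the own queue of MS `i` as a
linear functional. -/
def Freq.ownL {N : ℕ} {S K : Type} [Fintype S] [Fintype K] (i : Fin N) (s : S) (k : K) :
    Freq N S K →L[ℝ] ℝ :=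
  (ContinuousLinearMap.proj k).comp ((ContinuousLinearMap.proj s).comp
    ((ContinuousLinearMap.proj i).comp
      (ContinuousLinearMap.snd ℝ (S → K → ℝ) (Fin N → S → K → ℝ))))

@[simp]
lemma Freq.powL_apply {N : ℕ} {S K : Type} [Fintype S] [Fintype K] (s : S) (k : K)
    (z : Freq N S K) : Freq.powL s k z = z.1 s k := rfl

@[simp]
lemma Freq.ownL_apply {N : ℕ} {S K : Type} [Fintype S] [Fintype K] (i : Fin N) (s : S) (k : K)
    (z : Freq N S K) : Freq.ownL i s k z = z.2 i s k := rfl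

lemma Slot.norm_freq_le {N : ℕ} {S K : Type} [Fintype S] [Fintype K] (x : Slot N S K) :
    ‖x.freq‖ ≤ 1 := by
  classical
  refine norm_prod_le_iff.2 ⟨?_, ?_⟩
  · refine (pi_norm_le_iff_of_nonneg zero_le_one).2 fun s =>
      (pi_norm_le_iff_of_nonneg zero_le_one).2 fun k => ?_
    simp only [Slot.freq]
    split_ifs <;> simp
  · refine (pi_norm_le_iff_of_nonneg zero_le_one).2 fun i =>
      (pi_norm_le_iff_of_nonneg zero_le_one).2 fun s =>
      (pi_norm_le_iff_of_nonneg zero_le_one).2 fun k => ?_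
    simp only [Slot.freq]
    split_ifs <;> simp

lemma Slot.freq_nonneg {N : ℕ} {S K : Type} (x : Slot N S K) : 0 ≤ x.freq := by
  refine ⟨fun s k => ?_, fun i s k => ?_⟩ <;> simp only [Slot.freq] <;> split_ifs <;> simp

lemma Slot.freq_snd_le {N : ℕ} {S K : Type} (x : Slot N S K) (i : Fin N) (s : S) (k : K) :
    x.freq.2 i s k ≤ x.freq.1 s k := by
  simp only [Slot.freq]
  split_ifs with h1 h2 <;> first | simp | exact absurd ⟨h1.1, h1.2.1⟩ h2

open Classical in
lemma Slot.sum_freq {N : ℕ} {S K : Type} [Fintype K] (x : Slot N S K) (s : S) :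
    ∑ k, x.freq.1 s k = if x.top = s then 1 else 0 := by
  simp only [Slot.freq]
  split_ifs with h <;> simp [h]

lemma Slot.integrable_freq {N : ℕ} {S K : Type} [Fintype S] [Fintype K]
    (μ : Measure (Slot N S K)) [IsFiniteMeasure μ] :
    Integrable (fun x : Slot N S K => x.freq) μ :=
  Integrable.of_bound (Measurable.of_discrete).aestronglyMeasurable 1
    (ae_of_all _ fun x => x.norm_freq_le)

lemma measurableSet_slot {N : ℕ} {S K : Type} (p : Slot N S K → Prop) (n : ℕ) :
    MeasurableSet {ω : ℕ → Slot N S K | p (ω n)} :=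
  (measurable_pi_apply n : Measurable fun ω : ℕ → Slot N S K => ω n)
    (MeasurableSet.of_discrete (s := {x | p x}))

lemma measurableSet_past {N : ℕ} {S K : Type} {n : ℕ} (h : Fin n → Slot N S K) :
    MeasurableSet {ω : ℕ → Slot N S K | ∀ m : Fin n, ω m = h m} := by
  rw [Set.ofPred_forall]
  exact MeasurableSet.iInter fun m => measurableSet_slot (fun x => x = h m) m

namespace RelayNetwork

variable {N : ℕ} {S K : Type} [Fintype S] [Fintype K] (net : RelayNetwork N S K)

/-- Summing the one-step formula over arrivals and decisions leaves the topology mass, since both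
conditional laws have total mass 1 whatever the past. -/
lemma IsLaw.measure_past_top {net : RelayNetwork N S K} {ν : PMF (Fin N → ℕ)} {Δ : Policy N S K}
    {P : Measure (ℕ → Slot N S K)} (hP : net.IsLaw ν Δ P) (n : ℕ) (h : Fin n → Slot N S K) (s : S) :
    P {ω | (∀ m : Fin n, ω m = h m) ∧ (ω n).top = s} =
      P {ω | ∀ m : Fin n, ω m = h m} * ENNReal.ofReal (net.topLaw s) := by
  have hset : {ω : ℕ → Slot N S K | (∀ m : Fin n, ω m = h m) ∧ (ω n).top = s} =
      ⋃ p : (K × (Fin N → Bool)) × (Fin N → ℕ),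
        {ω | (∀ m : Fin n, ω m = h m) ∧ ω n = ⟨s, p.1.1, p.1.2, p.2⟩} := by
    ext ω
    simp only [Set.mem_ofPred_eq, Set.mem_iUnion]
    constructor
    · rintro ⟨h1, h2⟩
      exact ⟨(((ω n).pow, (ω n).own), (ω n).arr), h1, Slot.ext h2 rfl rfl rfl⟩
    · rintro ⟨p, h1, h2⟩
      exact ⟨h1, by rw [h2]⟩
  rw [hset, measure_iUnion]
  · simp only [hP.step, mul_assoc]
    rw [ENNReal.tsum_mul_left, ENNReal.tsum_mul_left,
      ENNReal.tsum_prod (f := fun (a : K × (Fin N → Bool)) r =>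
        ENNReal.ofReal (Δ.prob n h s a) * ν r)]
    have : ∀ a : K × (Fin N → Bool), ∑' r : Fin N → ℕ,
        ENNReal.ofReal (Δ.prob n h s a) * ν r = ENNReal.ofReal (Δ.prob n h s a) := by
      intro a
      rw [ENNReal.tsum_mul_left, ν.tsum_coe, mul_one]
    simp only [this]
    rw [tsum_fintype, ← ENNReal.ofReal_sum_of_nonneg fun a _ => Δ.prob_nonneg n h s a,
      Δ.prob_sum, ENNReal.ofReal_one, mul_one]
  · intro p p' hpp
    refine Set.disjoint_left.2 fun ω h1 h2 => hpp ?_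
    have := h1.2.symm.trans h2.2
    simp only [Slot.mk.injEq, true_and] at this
    exact Prod.ext (Prod.ext this.1 this.2.1) this.2.2
  · intro p
    exact (measurableSet_past h).inter (measurableSet_slot (fun x => x = _) n)

/-- The countably many possible pasts partition the trajectory space. -/
lemma IsLaw.measure_top {net : RelayNetwork N S K} {ν : PMF (Fin N → ℕ)} {Δ : Policy N S K}
    {P : Measure (ℕ → Slot N S K)} (hP : net.IsLaw ν Δ P) (n : ℕ) (s : S) :
    P {ω | (ω n).top = s} = ENNReal.ofReal (net.topLaw s) := by
  have hprob := hP.prob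
  have hdisj : Pairwise (Function.onFun Disjoint fun h : Fin n → Slot N S K =>
      {ω : ℕ → Slot N S K | ∀ m : Fin n, ω m = h m}) := by
    intro h h' hne
    exact Set.disjoint_left.2 fun ω h1 h2 => hne (funext fun m => (h1 m).symm.trans (h2 m))
  have hset : {ω : ℕ → Slot N S K | (ω n).top = s} =
      ⋃ h : Fin n → Slot N S K, {ω | (∀ m : Fin n, ω m = h m) ∧ (ω n).top = s} := by
    ext ω
    simp only [Set.mem_ofPred_eq, Set.mem_iUnion]
    exact ⟨fun h => ⟨fun m => ω m, fun _ => rfl, h⟩, fun ⟨_, _, h⟩ => h⟩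
  have huniv : (⋃ h : Fin n → Slot N S K, {ω : ℕ → Slot N S K | ∀ m : Fin n, ω m = h m}) =
      Set.univ := Set.eq_univ_of_forall fun ω => Set.mem_iUnion.2 ⟨fun m => ω m, fun _ => rfl⟩
  rw [hset, measure_iUnion]
  · simp only [hP.measure_past_top]
    rw [ENNReal.tsum_mul_right, ← measure_iUnion hdisj measurableSet_past, huniv, measure_univ, one_mul]
  · exact fun h h' hne => (hdisj hne).mono (fun ω hω => hω.1) (fun ω hω => hω.1)
  · exact fun h => (measurableSet_past h).inter (measurableSet_slot (fun x => x.top = s) n)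

/-- The expected frequencies in the first `T` slots. -/
def avgFreq (P : Measure (ℕ → Slot N S K)) (T : ℕ) : Freq N S K :=
  ∫ ω, (T : ℝ)⁻¹ • ∑ n ∈ Finset.range T, (ω n).freq ∂P

lemma integrable_freq_eval (P : Measure (ℕ → Slot N S K)) [IsFiniteMeasure P] (n : ℕ) :
    Integrable (fun ω : ℕ → Slot N S K => (ω n).freq) P :=
  Integrable.of_bound ((Measurable.of_discrete (f := fun x : Slot N S K => x.freq)).comp
    (measurable_pi_apply n)).aestronglyMeasurable 1 (ae_of_all _ fun ω => (ω n).norm_freq_le)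

/-- Continuous linear functionals commute with the integral, which reduces vector-valued averages to
scalar ones. -/
lemma apply_avgFreq (P : Measure (ℕ → Slot N S K)) [IsFiniteMeasure P] (T : ℕ)
    (L : Freq N S K →L[ℝ] ℝ) :
    L (avgFreq P T) = ∫ ω, (∑ n ∈ Finset.range T, L (ω n).freq) / (T : ℝ) ∂P := by
  unfold avgFreq
  have hint : Integrable (fun ω : ℕ → Slot N S K =>
      (T : ℝ)⁻¹ • ∑ n ∈ Finset.range T, (ω n).freq) P :=
    (integrable_finsetSum _ fun n _ => integrable_freq_eval P n).smul (T : ℝ)⁻¹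
  rw [← L.integral_comp_comm hint]
  refine integral_congr_ae (ae_of_all _ fun ω => ?_)
  simp only [map_smul, map_sum, smul_eq_mul]
  rw [inv_mul_eq_div]

/-- Dominated convergence: slot indicators have norm at most 1, so all averages are bounded by
`‖L‖`. -/
lemma HasTimeAverage.tendsto_avgFreq {P : Measure (ℕ → Slot N S K)} [IsProbabilityMeasure P]
    {L : Freq N S K →L[ℝ] ℝ} {a : ℝ} (h : HasTimeAverage P (fun x => L x.freq) a) :
    Tendsto (fun T => L (avgFreq P T)) atTop (𝓝 a) := by
  simp only [apply_avgFreq]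
  have hlim : ∫ _, a ∂P = a := by simp
  rw [← hlim]
  refine tendsto_integral_of_dominated_convergence (fun _ => ‖L‖) (fun T => ?_)
    (integrable_const _) (fun T => ae_of_all _ fun ω => ?_) h
  · exact ((integrable_finsetSum _ fun n _ =>
      L.integrable_comp (integrable_freq_eval P n)).div_const _).aestronglyMeasurable
  · rw [norm_div, Real.norm_natCast]
    refine div_le_of_le_mul₀ (Nat.cast_nonneg _) (norm_nonneg _) ?_
    refine (norm_sum_le_of_le (f := fun n => L (ω n).freq) (n := fun _ => ‖L‖) _ fun n _ =>
      (L.le_opNorm _).trans (mul_le_of_le_one_right (norm_nonneg _) (ω n).norm_freq_le)).trans ?_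
    simp [mul_comm]

/-- The inequalities hold slot by slot and survive averaging; the equality uses the topology
marginal of each slot. The empty average is 0, hence the need for `T ≠ 0`. -/
lemma IsLaw.avgFreq_mem {net : RelayNetwork N S K} {ν : PMF (Fin N → ℕ)} {Δ : Policy N S K}
    {P : Measure (ℕ → Slot N S K)} (hP : net.IsLaw ν Δ P) {T : ℕ} (hT : T ≠ 0) :
    avgFreq P T ∈ net.freqSet := by
  classical
  have hprob := hP.prob
  have nonneg : ∀ L : Freq N S K →L[ℝ] ℝ, (∀ x : Slot N S K, 0 ≤ L x.freq) →
      0 ≤ L (avgFreq P T) := by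
    intro L hL
    rw [apply_avgFreq]
    exact integral_nonneg fun ω =>
      div_nonneg (Finset.sum_nonneg fun n _ => hL _) (Nat.cast_nonneg _)
  refine ⟨fun s k => nonneg (Freq.powL s k) fun x => x.freq_nonneg.1 s k, fun s => ?_,
    fun i s k => nonneg (Freq.ownL i s k) fun x => x.freq_nonneg.2 i s k, fun i s k => ?_⟩
  · have h1 := apply_avgFreq P T (∑ k, Freq.powL s k)
    simp only [_root_.sum_apply, Freq.powL_apply, Slot.sum_freq] at h1
    have hmeas : ∀ n : ℕ, MeasurableSet {ω : ℕ → Slot N S K | (ω n).top = s} := fun n =>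
      measurableSet_slot (fun x => x.top = s) n
    have h2 : ∀ n : ℕ, ∫ ω, (if (ω n).top = s then (1 : ℝ) else 0) ∂P = net.topLaw s := by
      intro n
      have : (fun ω : ℕ → Slot N S K => if (ω n).top = s then (1 : ℝ) else 0) =
          Set.indicator {ω | (ω n).top = s} 1 := by
        ext ω
        simp [Set.indicator_apply]
      rw [this, integral_indicator_one (hmeas n), measureReal_def, hP.measure_top,
        ENNReal.toReal_ofReal (net.topLaw_nonneg s)]
    rw [h1, integral_div, integral_finsetSum]
    · simp only [h2, Finset.sum_const, Finset.card_range, nsmul_eq_mul]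
      have : (T : ℝ) ≠ 0 := by exact_mod_cast hT
      field_simp
    · intro n _
      refine Integrable.of_bound ((Measurable.ite (hmeas n) measurable_const
        measurable_const).aestronglyMeasurable) 1 (ae_of_all _ fun ω => ?_)
      split_ifs <;> simp
  · have := nonneg (Freq.powL s k - Freq.ownL i s k) fun x => by
      simpa using x.freq_snd_le i s k
    simpa using this

lemma IsLaw.mem_rateSet {net : RelayNetwork N S K} {ν : PMF (Fin N → ℕ)} {Δ : Policy N S K}
    {P : Measure (ℕ → Slot N S K)} (hP : net.IsLaw ν Δ P) {lam : Fin N → ℝ}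
    (hlam : ∀ i, 0 ≤ lam i) (hs : net.RateStable P lam) : lam ∈ net.rateSet := by
  have hprob := hP.prob
  obtain ⟨link, own, relay, pw, hlink, hown, hrelay, hpw, hX, hY, hU⟩ := hs
  -- The shift to `T + 1` avoids the empty average, which is not in `freqSet`.
  obtain ⟨z, hz, φ, hφ, hlim⟩ := net.isCompact_freqSet.tendsto_subseq
    (x := fun T => avgFreq P (T + 1)) fun T => hP.avgFreq_mem T.succ_ne_zero
  have ev : ∀ (i : Fin N) (c d : S → K → ℝ) (f : Slot N S K → ℝ) (a : ℝ),
      HasTimeAverage P f a → (∀ x : Slot N S K, Freq.eval i c d x.freq = f x) →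
      Freq.eval i c d z = a := by
    intro i c d f a h hf
    obtain rfl : (fun x : Slot N S K => Freq.evalL i c d x.freq) = f := funext hf
    exact tendsto_nhds_unique (((Freq.continuous_eval i c d).tendsto z).comp hlim)
      (h.tendsto_avgFreq.comp ((tendsto_add_atTop_nat 1).comp hφ.tendsto_atTop))
  have elink : ∀ i j, j ≠ i → net.meanLink i j z = link i j := fun i j hj =>
    ev i _ _ _ _ (hlink i j hj) (net.meanLink_freq i j)
  have eown : ∀ i, net.meanOwn i z = own i := fun i => ev i _ _ _ _ (hown i) (net.meanOwn_freq i)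
  have erelay : ∀ i, net.meanRelay i z = relay i := fun i =>
    ev i _ _ _ _ (hrelay i) (net.meanRelay_freq i)
  have epw : ∀ i, net.meanPower i z = pw i := fun i =>
    ev i _ _ _ _ (hpw i) (net.meanPower_freq i)
  refine (net.mem_rateSet_iff lam).2 ⟨hlam, z, hz, fun i => ?_, fun i => ?_, fun i => ?_⟩
  · rw [eown, Finset.sum_congr rfl fun j hj => elink i j (Finset.ne_of_mem_erase hj)]
    exact hX i
  · rw [erelay, Finset.sum_congr rfl fun j hj => elink j i (Finset.ne_of_mem_erase hj).symm]
    exact hY i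
  · rw [epw]
    exact hU i

end RelayNetwork

/-! ### The stationary randomized policy -/

/-- The success probability of one of several independent Bernoulli variables. -/
lemma sum_prod_bernoulli_mul_ite {ι : Type*} [Fintype ι] [DecidableEq ι] (q : ι → ℝ) (i : ι) :
    ∑ b : ι → Bool, (∏ j, if b j then q j else 1 - q j) * (if b i then 1 else 0) = q i := by
  -- The indicator is written as a product with trivial factors off `i`, so that the sum over `b`
  -- factorizes.
  have h1 : ∀ b : ι → Bool, (∏ j, if b j then q j else 1 - q j) * (if b i then 1 else 0) =
      ∏ j, (if b j then q j else 1 - q j) * (if j = i then (if b j then 1 else 0) else 1) := by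
    intro b
    rw [Finset.prod_mul_distrib, Finset.prod_ite_eq' Finset.univ i]
    simp
  have h2 := Finset.prod_univ_sum (fun _ : ι => (Finset.univ : Finset Bool))
    (fun j b => (if b then q j else 1 - q j) * (if j = i then (if b then 1 else 0) else 1))
  rw [Fintype.piFinset_univ] at h2
  rw [Finset.sum_congr rfl fun b _ => h1 b, ← h2]
  have h3 : ∀ j, ∑ b : Bool, (if b then q j else 1 - q j) *
      (if j = i then (if b then 1 else 0) else 1) = if j = i then q j else 1 := by
    intro j
    by_cases h : j = i <;> simp [h]
  rw [Finset.prod_congr rfl fun j _ => h3 j, Finset.prod_ite_eq' Finset.univ i]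
  simp

lemma sum_prod_bernoulli {ι : Type*} [Fintype ι] [DecidableEq ι] (q : ι → ℝ) :
    ∑ b : ι → Bool, (∏ j, if b j then q j else 1 - q j) = 1 := by
  have h2 := Finset.prod_univ_sum (fun _ : ι => (Finset.univ : Finset Bool))
    (fun j b => if b then q j else 1 - q j)
  rw [Fintype.piFinset_univ] at h2
  rw [← h2]
  simp

/-- Strong law of large numbers for a function of the terms of an i.i.d. sequence. -/
lemma ae_tendsto_avg_infinitePi {E : Type*} [MeasurableSpace E] (μ : Measure E)
    [IsProbabilityMeasure μ] {f : E → ℝ} (hf : Measurable f) (hint : Integrable f μ) :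
    ∀ᵐ ω ∂(Measure.infinitePi fun _ : ℕ => μ),
      Tendsto (fun T : ℕ => (∑ n ∈ Finset.range T, f (ω n)) / (T : ℝ)) atTop
        (𝓝 (∫ x, f x ∂μ)) := by
  have hmp := fun n : ℕ => measurePreserving_eval_infinitePi (fun _ : ℕ => μ) n
  have h := ProbabilityTheory.strong_law_ae_real
    (μ := Measure.infinitePi fun _ : ℕ => μ) (fun n ω => f (ω n))
    ((hmp 0).integrable_comp_of_integrable hint)
    (fun m n hmn => (ProbabilityTheory.iIndepFun_infinitePi (P := fun _ : ℕ => μ)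
      (X := fun _ => f) (fun _ => hf)).indepFun hmn)
    (fun n => ⟨(hf.comp (measurable_pi_apply n)).aemeasurable,
      (hf.comp (measurable_pi_apply 0)).aemeasurable, by
        change Measure.map (f ∘ fun ω : ℕ → E => ω n) _ = Measure.map (f ∘ fun ω : ℕ → E => ω 0) _
        rw [← Measure.map_map hf (measurable_pi_apply n),
          ← Measure.map_map hf (measurable_pi_apply 0)]
        exact congrArg _ ((hmp n).map_eq.trans (hmp 0).map_eq.symm)⟩)
  have hI : ∫ ω, f (ω 0) ∂(Measure.infinitePi fun _ : ℕ => μ) = ∫ x, f x ∂μ := by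
    conv_rhs => rw [← (hmp 0).map_eq]
    exact (integral_map (measurable_pi_apply 0).aemeasurable hf.aestronglyMeasurable).symm
  rw [hI] at h
  exact h

namespace RelayNetwork

variable {N : ℕ} {S K : Type} [Fintype S] [Fintype K] (net : RelayNetwork N S K)

/-- The law of the topology, the power vector and the queue selection of one slot under a stationary
randomized policy. -/
def decisionLaw (ρ : StationaryRule N S K) : PMF (S × K × (Fin N → Bool)) :=
  PMF.ofFintype (fun a => ENNReal.ofReal (net.topLaw a.1 *
      (ρ.w a.1 a.2.1 * ∏ i, (if a.2.2 i then ρ.q i a.1 a.2.1 else 1 - ρ.q i a.1 a.2.1)))) <| by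
    rw [← ENNReal.ofReal_sum_of_nonneg fun a _ => mul_nonneg (net.topLaw_nonneg _)
      (ρ.toPolicy.prob_nonneg 0 Fin.elim0 a.1 a.2), Fintype.sum_prod_type]
    have h : ∀ s : S, ∑ a : K × (Fin N → Bool), net.topLaw s *
        (ρ.w s a.1 * ∏ i, (if a.2 i then ρ.q i s a.1 else 1 - ρ.q i s a.1)) = net.topLaw s :=
      fun s => by
        rw [← Finset.mul_sum]
        exact (congrArg _ (ρ.toPolicy.prob_sum 0 Fin.elim0 s)).trans (mul_one _)
    simp only [h, net.topLaw_sum, ENNReal.ofReal_one]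

/-- The law of one slot under a stationary randomized policy. -/
def slotLaw (ρ : StationaryRule N S K) (ν : PMF (Fin N → ℕ)) : PMF (Slot N S K) :=
  (net.decisionLaw ρ).bind fun a => ν.map fun r => ⟨a.1, a.2.1, a.2.2, r⟩

lemma slotLaw_apply (ρ : StationaryRule N S K) (ν : PMF (Fin N → ℕ)) (x : Slot N S K) :
    net.slotLaw ρ ν x = net.decisionLaw ρ (x.top, x.pow, x.own) * ν x.arr := by
  classical
  rw [slotLaw, PMF.bind_apply, tsum_eq_single (x.top, x.pow, x.own)]
  · rw [PMF.map_apply, tsum_eq_single x.arr]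
    · simp
    · intro r hr
      rw [if_neg]
      intro h
      exact hr (congrArg Slot.arr h).symm
  · intro a ha
    rw [PMF.map_apply, ENNReal.tsum_eq_zero.2, mul_zero]
    intro r
    rw [if_neg]
    rintro rfl
    exact ha rfl

lemma slotLaw_map_arr (ρ : StationaryRule N S K) (ν : PMF (Fin N → ℕ)) :
    (net.slotLaw ρ ν).map Slot.arr = ν := by
  have h : ∀ a : S × K × (Fin N → Bool),
      (Slot.arr ∘ fun r : Fin N → ℕ => (⟨a.1, a.2.1, a.2.2, r⟩ : Slot N S K)) = id :=
    fun _ => rfl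
  simp [slotLaw, PMF.map_bind, PMF.map_comp, h, PMF.map_id]

lemma slotLaw_map_decision (ρ : StationaryRule N S K) (ν : PMF (Fin N → ℕ)) :
    (net.slotLaw ρ ν).map (fun x => (x.top, x.pow, x.own)) = net.decisionLaw ρ := by
  have h : ∀ a : S × K × (Fin N → Bool), ((fun x : Slot N S K => (x.top, x.pow, x.own)) ∘
      fun r : Fin N → ℕ => (⟨a.1, a.2.1, a.2.2, r⟩ : Slot N S K)) = Function.const _ a :=
    fun _ => rfl
  simp only [slotLaw, PMF.map_bind, PMF.map_comp, h, PMF.map_const]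
  exact PMF.bind_pure _

lemma integral_slotLaw_decision (ρ : StationaryRule N S K) (ν : PMF (Fin N → ℕ))
    (f : S × K × (Fin N → Bool) → ℝ) :
    ∫ x, f (x.top, x.pow, x.own) ∂(net.slotLaw ρ ν).toMeasure =
      ∑ s, ∑ k, ∑ b : Fin N → Bool, net.topLaw s *
        (ρ.w s k * ∏ i, (if b i then ρ.q i s k else 1 - ρ.q i s k)) * f (s, k, b) := by
  let _ : MeasurableSpace (S × K × (Fin N → Bool)) := ⊤
  have : DiscreteMeasurableSpace (S × K × (Fin N → Bool)) := ⟨fun _ => trivial⟩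
  have hm : Measurable fun x : Slot N S K => (x.top, x.pow, x.own) := Measurable.of_discrete
  have h := integral_map (μ := (net.slotLaw ρ ν).toMeasure) hm.aemeasurable (f := f)
    (Measurable.of_discrete.aestronglyMeasurable)
  rw [PMF.toMeasure_map (hf := hm), slotLaw_map_decision, PMF.integral_eq_sum] at h
  rw [← h, Fintype.sum_prod_type]
  refine Finset.sum_congr rfl fun s _ => ?_
  rw [Fintype.sum_prod_type]
  refine Finset.sum_congr rfl fun k _ => Finset.sum_congr rfl fun b _ => ?_
  rw [decisionLaw, PMF.ofFintype_apply, ENNReal.toReal_ofReal, smul_eq_mul]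
  exact mul_nonneg (net.topLaw_nonneg _) (ρ.toPolicy.prob_nonneg 0 Fin.elim0 s (k, b))

/-- Checked coordinate by coordinate: the queue selections sum to 1 in the first component, and
leave the factor `q i s k` in the second. -/
lemma integral_freq (ρ : StationaryRule N S K) (ν : PMF (Fin N → ℕ)) :
    ∫ x, x.freq ∂(net.slotLaw ρ ν).toMeasure = net.ruleFreq ρ := by
  classical
  have hL : ∀ L : Freq N S K →L[ℝ] ℝ, L (∫ x, x.freq ∂(net.slotLaw ρ ν).toMeasure) =
      ∫ x, L x.freq ∂(net.slotLaw ρ ν).toMeasure := fun L =>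
    (L.integral_comp_comm (Slot.integrable_freq _)).symm
  refine Prod.ext (funext fun s => funext fun k => ?_)
    (funext fun i => funext fun s => funext fun k => ?_)
  · refine (hL (Freq.powL s k)).trans ?_
    refine (net.integral_slotLaw_decision ρ ν
      fun a => if a.1 = s ∧ a.2.1 = k then 1 else 0).trans ?_
    rw [Finset.sum_eq_single_of_mem s (Finset.mem_univ _) fun s' _ hs => by simp [hs],
      Finset.sum_eq_single_of_mem k (Finset.mem_univ _) fun k' _ hk => by simp [hk]]
    simp only [and_self, if_true, mul_one]
    rw [← Finset.mul_sum, ← Finset.mul_sum, sum_prod_bernoulli, mul_one]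
    rfl
  · refine (hL (Freq.ownL i s k)).trans ?_
    refine (net.integral_slotLaw_decision ρ ν
      fun a => if a.1 = s ∧ a.2.1 = k ∧ a.2.2 i then 1 else 0).trans ?_
    rw [Finset.sum_eq_single_of_mem s (Finset.mem_univ _) fun s' _ hs => by simp [hs],
      Finset.sum_eq_single_of_mem k (Finset.mem_univ _) fun k' _ hk => by simp [hk]]
    simp only [true_and, mul_assoc]
    rw [← Finset.mul_sum, ← Finset.mul_sum, sum_prod_bernoulli_mul_ite fun i => ρ.q i s k]
    simp only [ruleFreq, mul_assoc]

/-- The law of the trajectory under a stationary randomized policy: the slots are i.i.d. -/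
def stationaryLaw (ρ : StationaryRule N S K) (ν : PMF (Fin N → ℕ)) :
    Measure (ℕ → Slot N S K) :=
  Measure.infinitePi fun _ : ℕ => (net.slotLaw ρ ν).toMeasure

lemma isLaw_stationaryLaw (ρ : StationaryRule N S K) (ν : PMF (Fin N → ℕ)) :
    net.IsLaw ν ρ.toPolicy (net.stationaryLaw ρ ν) where
  prob := by
    unfold stationaryLaw
    infer_instance
  step n h x := by
    classical
    -- Both events are boxes of one-point sets over the first `n`, respectively `n + 1`,
    -- coordinates; values of `t` beyond `n` play no role.
    set t : ℕ → Set (Slot N S K) := fun m => if hm : m < n then {h ⟨m, hm⟩} else {x} with ht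
    have h1 : {ω : ℕ → Slot N S K | ∀ m : Fin n, ω m = h m} =
        Set.pi (Finset.range n : Set ℕ) t := by
      ext ω
      simp only [Set.mem_ofPred_eq, Set.mem_pi, Finset.coe_range, Set.mem_Iio]
      refine ⟨fun hω m hm => ?_, fun hω m => ?_⟩
      · simp [ht, hm, hω ⟨m, hm⟩]
      · simpa [ht] using hω m m.2
    have h2 : {ω : ℕ → Slot N S K | (∀ m : Fin n, ω m = h m) ∧ ω n = x} =
        Set.pi (Finset.range (n + 1) : Set ℕ) t := by
      rw [Finset.range_add_one, Finset.coe_insert, Set.insert_pi, Set.inter_comm, ← h1]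
      ext ω
      simp [ht]
    have hmeas : ∀ m, MeasurableSet (t m) := fun m => MeasurableSet.of_discrete
    rw [h1, h2, stationaryLaw, Measure.infinitePi_pi _ fun m _ => hmeas m,
      Measure.infinitePi_pi _ fun m _ => hmeas m, Finset.prod_range_succ]
    congr 1
    simp only [ht, lt_irrefl, dite_false]
    rw [PMF.toMeasure_apply_singleton _ _ (MeasurableSet.singleton x), slotLaw_apply, decisionLaw,
      PMF.ofFintype_apply, ENNReal.ofReal_mul (net.topLaw_nonneg _)]
    rfl

lemma hasTimeAverage_eval (ρ : StationaryRule N S K) (ν : PMF (Fin N → ℕ)) (i : Fin N)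
    (c d : S → K → ℝ) {f : Slot N S K → ℝ} (hf : ∀ x, Freq.eval i c d x.freq = f x) :
    HasTimeAverage (net.stationaryLaw ρ ν) f (Freq.eval i c d (net.ruleFreq ρ)) := by
  obtain rfl : (fun x : Slot N S K => Freq.evalL i c d x.freq) = f := funext hf
  have h := ae_tendsto_avg_infinitePi (net.slotLaw ρ ν).toMeasure Measurable.of_discrete
    ((Freq.evalL i c d).integrable_comp (Slot.integrable_freq _))
  rw [(Freq.evalL i c d).integral_comp_comm (Slot.integrable_freq _), integral_freq] at h
  exact h

/-- The arrival marginal of a slot is the given law; its boundedness supplies the integrability for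
the strong law. -/
lemma hasTimeAverage_arr (ρ : StationaryRule N S K) (arr : ArrivalFamily N) {lam : Fin N → ℝ}
    (hlam : ∀ i, 0 ≤ lam i) (i : Fin N) :
    HasTimeAverage (net.stationaryLaw ρ (arr.law lam)) (fun x => (x.arr i : ℝ)) (lam i) := by
  obtain ⟨A, hA⟩ := arr.bounded lam hlam
  have hm : Measurable (Slot.arr : Slot N S K → Fin N → ℕ) := Measurable.of_discrete
  have hmap := PMF.toMeasure_map (p := net.slotLaw ρ (arr.law lam)) (hf := hm)
  rw [slotLaw_map_arr] at hmap
  have hint : Integrable (fun a : Fin N → ℕ => (a i : ℝ)) (arr.law lam).toMeasure := by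
    refine Integrable.of_bound (Measurable.of_discrete).aestronglyMeasurable (A : ℝ) ?_
    rw [ae_iff, PMF.toMeasure_apply_eq_zero_iff _ MeasurableSet.of_discrete]
    refine Set.disjoint_left.2 fun a ha h => h ?_
    rw [Real.norm_natCast]
    exact_mod_cast hA a ha i
  have hmean : ∫ a, (a i : ℝ) ∂(arr.law lam).toMeasure = lam i := by
    rw [PMF.integral_eq_tsum _ _ hint]
    exact (arr.mean lam hlam i).tsum_eq
  rw [← hmap] at hint hmean
  rw [integral_map hm.aemeasurable Measurable.of_discrete.aestronglyMeasurable] at hmean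
  have h := ae_tendsto_avg_infinitePi (net.slotLaw ρ (arr.law lam)).toMeasure
    (f := fun x => (x.arr i : ℝ)) Measurable.of_discrete (hint.comp_measurable hm)
  rw [hmean] at h
  exact h

/-- Rate vectors supported by the parameters of a stationary randomized policy are rate stable under
this policy, and with at most one active link per mobile station the queues grow sublinearly. -/
lemma Supports.rateStable {net : RelayNetwork N S K} {ρ : StationaryRule N S K} {lam : Fin N → ℝ}
    (h : net.Supports ρ lam) (hlam : ∀ i, 0 ≤ lam i) (arr : ArrivalFamily N) :
    net.RateStable (net.stationaryLaw ρ (arr.law lam)) lam ∧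
      (net.SingleReceiver → ∀ Q0 : QueueState N,
        (∀ i, 0 ≤ Q0.X i ∧ 0 ≤ Q0.Y i ∧ 0 ≤ Q0.U i) →
        ∀ᵐ ω ∂(net.stationaryLaw ρ (arr.law lam)), ∀ i,
          Tendsto (fun n : ℕ => (net.queues Q0 ω n).X i / (n : ℝ)) atTop (𝓝 0) ∧
          Tendsto (fun n : ℕ => (net.queues Q0 ω n).Y i / (n : ℝ)) atTop (𝓝 0) ∧
          Tendsto (fun n : ℕ => (net.queues Q0 ω n).U i / (n : ℝ)) atTop (𝓝 0)) := by
  obtain ⟨hX, hY, hU⟩ := (net.supports_iff ρ lam).1 h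
  have hlink := fun i j => net.hasTimeAverage_eval ρ (arr.law lam) i _ _ (net.meanLink_freq i j)
  have hown := fun i => net.hasTimeAverage_eval ρ (arr.law lam) i _ _ (net.meanOwn_freq i)
  have hrelay := fun i => net.hasTimeAverage_eval ρ (arr.law lam) i _ _ (net.meanRelay_freq i)
  have hpw := fun i => net.hasTimeAverage_eval ρ (arr.law lam) i _ _ (net.meanPower_freq i)
  refine ⟨⟨fun i j => net.meanLink i j (net.ruleFreq ρ), fun i => net.meanOwn i (net.ruleFreq ρ),
    fun i => net.meanRelay i (net.ruleFreq ρ), fun i => net.meanPower i (net.ruleFreq ρ),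
    fun i j _ => hlink i j, hown, hrelay, hpw, hX, hY, hU⟩, fun hsr Q0 hQ => ?_⟩
  filter_upwards [ae_all_iff.2 fun i => ae_all_iff.2 (hlink i), ae_all_iff.2 hown,
    ae_all_iff.2 hrelay, ae_all_iff.2 hpw,
    ae_all_iff.2 (net.hasTimeAverage_arr ρ arr hlam)] with ω h1 h2 h3 h4 h5
  exact hsr.tendsto_queues_div hQ h5 (fun i j _ => h1 i j) h2 h3 h4 hX hY hU

lemma stabilityRegion_eq_rateSet (arr : ArrivalFamily N) :
    net.stabilityRegion arr = net.rateSet := by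
  refine Set.Subset.antisymm ?_ ?_
  · rintro lam ⟨hlam, Δ, P, hP, hs⟩
    exact hP.mem_rateSet hlam hs
  · rintro lam ⟨hlam, ρ, hρ⟩
    exact ⟨hlam, ρ.toPolicy, _, net.isLaw_stationaryLaw ρ _, (hρ.rateStable hlam arr).1⟩

end RelayNetwork

end

theorem theorem1 {N : ℕ} {S K : Type} [Fintype S] [Fintype K]
    (net : RelayNetwork N S K) (arr : ArrivalFamily N) :
    closure (net.stabilityRegion arr) = net.rateSet ∧
    net.stabilityRegion arr = net.rateSet ∧
    ∀ (lam : Fin N → ℝ) (ρ : StationaryRule N S K), (∀ i, 0 ≤ lam i) → net.Supports ρ lam →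
      ∃ P : Measure (ℕ → Slot N S K), net.IsLaw (arr.law lam) ρ.toPolicy P ∧
        net.RateStable P lam ∧
        (net.SingleReceiver → ∀ Q0 : QueueState N,
          (∀ i, 0 ≤ Q0.X i ∧ 0 ≤ Q0.Y i ∧ 0 ≤ Q0.U i) → ∀ᵐ ω ∂P, ∀ i,
            Tendsto (fun n : ℕ => (net.queues Q0 ω n).X i / (n : ℝ)) atTop (𝓝 0) ∧
            Tendsto (fun n : ℕ => (net.queues Q0 ω n).Y i / (n : ℝ)) atTop (𝓝 0) ∧
            Tendsto (fun n : ℕ => (net.queues Q0 ω n).U i / (n : ℝ)) atTop (𝓝 0)) := by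
  refine ⟨?_, net.stabilityRegion_eq_rateSet arr, fun lam ρ hlam hρ =>
    ⟨_, net.isLaw_stationaryLaw ρ _, hρ.rateStable hlam arr⟩⟩
  rw [net.stabilityRegion_eq_rateSet arr, net.isClosed_rateSet.closure_eq]
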